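/- Fix a set $X$. A representation of a set $Z$ is a surjective partial map $\delta:\subseteq\mathbb{N}^{\mathbb{N}}\to Z$; its final topology $\mathcal{O}(Z)$ consists of all $U\subseteq Z$ such that $\delta^{-1}(U)$ is open in $\mathrm{dom}(\delta)\subseteq\mathbb{N}^{\mathbb{N}}$, and $\delta_{\mathcal{O}(Z)}:\subseteq\mathbb{N}^{\mathbb{N}}\to\mathcal{O}(Z)$ denotes the induced representation of the open sets, i.e. $p$ is a name of $U$ if and only if $p$ is a name, in the function space representation, of the characteristic function $\chi_U:Z\to\mathbb{S}$ into Sierpiński space $\mathbb{S}$ (in which the zero sequence is the only name of $0$ and every other sequence is a name of $1$). A partial map $B:\subseteq\mathbb{N}^{\mathbb{N}}\to 2^X$ with domain $D$, where $D$ is represented by the identity on $D$ (so that $\mathcal{O}(D)$ is the subspace topology), is called a presubbase for $X$ if the transpose $B^{\mathsf T}:X\to\mathcal{O}(D)$, $x\mapsto\{y\in D: x\in B(y)\}$ is well-defined and injective. Its presubbase representation $\delta^B:\subseteq\mathbb{N}^{\mathbb{N}}\to X$ is defined by $\delta^B(p)=x:\iff\delta_{\mathcal{O}(D)}(p)=\{y\in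 D:x\in B(y)\}$. Let $\mathsf{REP}_0$ be the set of representations of $X$ with a $T_0$ final topology, and let $\mathsf{PRE}_0$ be the set of presubbases $B:\subseteq\mathbb{N}^{\mathbb{N}}\to 2^X$ that induce (as a subbase) a $T_0$ topology on $X$. Both sets are preordered by computable reducibility: $f\le g$ if there is a computable $F:\subseteq\mathbb{N}^{\mathbb{N}}\to\mathbb{N}^{\mathbb{N}}$ with $f(p)=g(F(p))$ for all $p\in\mathrm{dom}(f)$. For $\delta\in\mathsf{REP}_0$ let $B_\delta:\subseteq\mathbb{N}^{\mathbb{N}}\to 2^X$ be the representation $\delta_{\mathcal{O}(X)}$ regarded as a partial map into $2^X$. Then $\delta\mapsto B_\delta$ is a map $\mathsf{REP}_0\to\mathsf{PRE}_0$, $B\mapsto\delta^B$ is a map $\mathsf{PRE}_0\to\mathsf{REP}_0$, and for all $\delta\in\mathsf{REP}_0$ and $B\in\mathsf{PRE}_0$ $$\delta\le\delta^B\iff B\le B_\delta .$$ That is, the maps $\delta\mapsto B_\delta$ and $B\mapsto\delta^B$ form an antitone Galois connection between $\mathsf{REP}_0$ and $\mathsf{PRE}_0$. -/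

import Mathlib

/-! # Representations, open-set representations, presubbases -/

open scoped Topology

/-- Baire space `ℕ^ℕ`, with the product topology of the discrete topology on `ℕ`. -/
abbrev Baire : Type := ℕ → ℕ

namespace Baire

/-- The finite initial segment `p(0), …, p(n-1)`. -/
def pref (p : Baire) (n : ℕ) : List ℕ := (List.range n).map p

/-- The finite word `w` is an initial segment of `p`. -/
def Extends (p : Baire) (w : List ℕ) : Prop := w = p.pref w.length

@[simp] theorem length_pref (p : Baire) (n : ℕ) : (p.pref n).length = n := by
  simp [pref]

theorem pref_congr {p q : Baire} {n : ℕ} : p.pref n = q.pref n ↔ ∀ i < n, p i = q i := by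
  simp [pref]

theorem extends_pref (p : Baire) (n : ℕ) : p.Extends (p.pref n) := by
  simp [Extends]

theorem pref_prefix (p : Baire) {m n : ℕ} (h : m ≤ n) : p.pref m <+: p.pref n := by
  unfold pref
  apply List.IsPrefix.map
  obtain ⟨k, rfl⟩ := Nat.exists_eq_add_of_le h
  rw [List.range_add]
  exact List.prefix_append _ _

/-- Type-2 computability of a partial function `F :⊆ ℕ^ℕ → ℕ^ℕ`: some computable monotone function
on finite words maps the initial segments of each `p ∈ dom F` to initial segments of `F(p)` of
unbounded length. Like for Type-2 machines, only the behaviour on `dom F` is constrained. -/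
def IsComputable (F : Baire →. Baire) : Prop :=
  ∃ f : List ℕ → List ℕ, Computable f ∧ (∀ u v, u <+: v → f u <+: f v) ∧
    ∀ p, ∀ r ∈ F p, (∀ n, r.Extends (f (p.pref n))) ∧ ∀ k, ∃ n, k ≤ (f (p.pref n)).length

/-- Kleene's application on Baire space: `(p • q)(n) + 1` is the first nonzero value among
`p(⟨n, q(0), …, q(m-1)⟩)`, `m = 0, 1, 2, …`; it is defined if there is such a value for each `n`.
The maps `q ↦ p • q` are the universal family of continuous partial functions on Baire space. -/
def app (p q : Baire) : Part Baire where
  Dom := ∀ n, ∃ m, p (Encodable.encode (n :: q.pref m)) ≠ 0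
  get h n := p (Encodable.encode (n :: q.pref (Nat.find (h n)))) - 1

end Baire

/-- Computable reducibility of partial maps on Baire space: `f(p) = g(F(p))` for all `p ∈ dom f`,
for some computable `F :⊆ ℕ^ℕ → ℕ^ℕ`. -/
def ComputablyReducible {α : Type*} (f g : Baire →. α) : Prop :=
  ∃ F : Baire →. Baire, Baire.IsComputable F ∧ ∀ p, ∀ a ∈ f p, ∃ q ∈ F p, a ∈ g q

theorem ComputablyReducible.refl {α : Type*} (f : Baire →. α) : ComputablyReducible f f := by
  refine ⟨fun p => Part.some p, ⟨id, Computable.id, fun _ _ h => h, ?_⟩, ?_⟩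
  · intro p r hr
    obtain rfl := Part.mem_some_iff.1 hr
    exact ⟨fun n => r.extends_pref n, fun k => ⟨k, by simp⟩⟩
  · intro p a ha
    exact ⟨p, Part.mem_some p, ha⟩

theorem ComputablyReducible.trans {α : Type*} {f g h : Baire →. α}
    (h₁ : ComputablyReducible f g) (h₂ : ComputablyReducible g h) : ComputablyReducible f h := by
  obtain ⟨F, ⟨a, hac, ham, ha⟩, hF⟩ := h₁
  obtain ⟨G, ⟨b, hbc, hbm, hb⟩, hG⟩ := h₂
  refine ⟨fun p => (F p).bind G, ⟨fun w => b (a w), hbc.comp hac,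
    fun u v huv => hbm _ _ (ham _ _ huv), ?_⟩, ?_⟩
  · intro p r hr
    obtain ⟨q, hq, hr⟩ := Part.mem_bind_iff.1 hr
    obtain ⟨ha₁, ha₂⟩ := ha p q hq
    obtain ⟨hb₁, hb₂⟩ := hb q r hr
    constructor
    · intro n
      have h := hb₁ (a (p.pref n)).length
      rwa [← ha₁ n] at h
    · intro k
      obtain ⟨m, hm⟩ := hb₂ k
      obtain ⟨n, hn⟩ := ha₂ m
      refine ⟨n, hm.trans ?_⟩
      have h := (hbm _ _ (q.pref_prefix hn)).length_le
      rwa [← ha₁ n] at h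
  · intro p x hx
    obtain ⟨q, hq, hx⟩ := hF p x hx
    obtain ⟨r, hr, hx⟩ := hG q x hx
    exact ⟨r, Part.mem_bind_iff.2 ⟨q, hq, hr⟩, hx⟩

/-- A representation of `X` : a surjective partial map `δ :⊆ ℕ^ℕ → X`. -/
structure BaireRep (X : Type*) where
  /-- the partial map -/
  toPFun : Baire →. X
  surj : ∀ x, ∃ p, x ∈ toPFun p

namespace BaireRep

variable {X Y : Type*}

/-- The final topology: `U` is open iff `δ⁻¹(U)` is open in `dom δ`. -/
@[reducible] def finalTopology (δ : BaireRep X) : TopologicalSpace X :=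
  TopologicalSpace.coinduced δ.toPFun.asSubtype inferInstance

/-- The name `p` realizes `f : X → Y`, that is, `q ↦ p • q` maps names of `x` to names of
`f x`. -/
def Realizes (δX : BaireRep X) (δY : BaireRep Y) (p : Baire) (f : X → Y) : Prop :=
  ∀ q, ∀ x ∈ δX.toPFun q, ∃ r ∈ Baire.app p q, f x ∈ δY.toPFun r

/-- The function space representation: `p` is a name of the function that it realizes. -/
noncomputable def funRep (δX : BaireRep X) (δY : BaireRep Y) : Baire →. (X → Y) :=
  fun p => ⟨∃ f, Realizes δX δY p f, fun h => h.choose⟩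

theorem Realizes.unique {δX : BaireRep X} {δY : BaireRep Y} {p : Baire} {f g : X → Y}
    (hf : Realizes δX δY p f) (hg : Realizes δX δY p g) : f = g := by
  funext x
  obtain ⟨q, hq⟩ := δX.surj x
  obtain ⟨r, hr, hfr⟩ := hf q x hq
  obtain ⟨s, hs, hgs⟩ := hg q x hq
  obtain rfl := Part.mem_unique hr hs
  exact Part.mem_unique hfr hgs

theorem mem_funRep {δX : BaireRep X} {δY : BaireRep Y} {p : Baire} {f : X → Y} :
    f ∈ funRep δX δY p ↔ Realizes δX δY p f := by
  constructor
  · rintro ⟨h, rfl⟩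
    exact h.choose_spec
  · intro h
    have h' : ∃ f, Realizes δX δY p f := ⟨f, h⟩
    exact ⟨h', h'.choose_spec.unique h⟩

/-- The standard representation of Sierpiński space, with underlying set `Prop`: the zero sequence
is the only name of `False`, all other sequences are names of `True`. -/
def sierpinski : BaireRep Prop where
  toPFun p := Part.some (∃ n, p n ≠ 0)
  surj P := by
    by_cases h : P
    · exact ⟨fun _ => 1, by simp [h]⟩
    · exact ⟨fun _ => 0, by simp [h]⟩

/-- The representation `δ_{𝒪(X)}` of the open subsets of `X`, as a partial map from Baire space to
the power set: `p` is a name of `U` iff it is a name of the characteristic function of `U` as a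
map into Sierpiński space. -/
noncomputable def openRep (δ : BaireRep X) : Baire →. Set X :=
  (funRep δ sierpinski).map fun χ => {x | χ x}

theorem mem_openRep {δ : BaireRep X} {p : Baire} {U : Set X} :
    U ∈ δ.openRep p ↔ Realizes δ sierpinski p (fun x => x ∈ U) := by
  rw [← mem_funRep]
  constructor
  · intro h
    obtain ⟨χ, hχ, rfl⟩ := (Part.mem_map_iff _).1 h
    exact hχ
  · intro h
    exact (Part.mem_map_iff _).2 ⟨_, h, rfl⟩

end BaireRep

namespace Baire

/-- The pairs `(p, q)` such that `p • q` takes a nonzero value, as far as `p • q` is defined. -/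
def Accepts (p q : Baire) : Prop :=
  ∃ n m, (∀ j < m, p (Encodable.encode (n :: q.pref j)) = 0) ∧
    2 ≤ p (Encodable.encode (n :: q.pref m))

theorem accepts_iff {p q r : Baire} (h : r ∈ app p q) : Accepts p q ↔ ∃ n, r n ≠ 0 := by
  obtain ⟨hd, rfl⟩ := h
  constructor
  · rintro ⟨n, m, h₁, h₂⟩
    refine ⟨n, ?_⟩
    have : Nat.find (hd n) = m := by
      rw [Nat.find_eq_iff]
      exact ⟨by omega, fun j hj => not_not.2 (h₁ j hj)⟩
    simp only [app, this]
    omega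
  · rintro ⟨n, hn⟩
    refine ⟨n, Nat.find (hd n), fun j hj => not_not.1 (Nat.find_min (hd n) hj), ?_⟩
    simp only [app] at hn
    omega

theorem continuous_query (n m : ℕ) :
    Continuous fun x : Baire × Baire => x.1 (Encodable.encode (n :: x.2.pref m)) := by
  have h₁ : Continuous fun q : Baire => Encodable.encode (n :: q.pref m) := by
    have : (fun q : Baire => Encodable.encode (n :: q.pref m)) =
        (fun v : Fin m → ℕ => Encodable.encode (n :: List.ofFn v)) ∘
          fun (q : Baire) (i : Fin m) => q i := by
      funext q
      simp only [Function.comp, pref]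
      congr 2
      apply List.ext_getElem <;> simp
    rw [this]
    exact continuous_of_discreteTopology.comp (by fun_prop)
  have h₂ : Continuous fun x : Baire × ℕ => x.1 x.2 := by
    rw [continuous_iff_continuousAt]
    rintro ⟨p, c⟩
    have h : Filter.Tendsto (fun x : Baire × ℕ => x.1 c) (nhds (p, c)) (nhds (p c)) :=
      ((continuous_apply c).comp continuous_fst).tendsto (p, c)
    refine Filter.Tendsto.congr' ?_ h
    have : ∀ᶠ x : Baire × ℕ in nhds (p, c), x.2 = c :=
      ((isOpen_discrete ({c} : Set ℕ)).preimage continuous_snd).mem_nhds rfl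
    filter_upwards [this] with x hx
    rw [hx]
  exact h₂.comp (continuous_fst.prodMk (h₁.comp continuous_snd))

theorem isOpen_accepts : IsOpen {x : Baire × Baire | Accepts x.1 x.2} := by
  have : {x : Baire × Baire | Accepts x.1 x.2} = ⋃ n, ⋃ m,
      ((⋂ j ∈ Finset.range m, (fun x : Baire × Baire =>
          x.1 (Encodable.encode (n :: x.2.pref j))) ⁻¹' {0}) ∩
        (fun x : Baire × Baire => x.1 (Encodable.encode (n :: x.2.pref m))) ⁻¹' {c | 2 ≤ c}) := by
    ext x
    simp [Accepts]
  rw [this]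
  refine isOpen_iUnion fun n => isOpen_iUnion fun m => IsOpen.inter ?_ ?_
  · exact isOpen_biInter_finset fun j _ => (isOpen_discrete _).preimage (continuous_query n j)
  · exact (isOpen_discrete _).preimage (continuous_query n m)

end Baire

namespace BaireRep

variable {X Y : Type*}

theorem mem_iff_accepts {δ : BaireRep X} {p q : Baire} {U : Set X} {x : X}
    (hU : U ∈ δ.openRep p) (hx : x ∈ δ.toPFun q) : x ∈ U ↔ Baire.Accepts p q := by
  obtain ⟨r, hr, h⟩ := mem_openRep.1 hU q x hx
  rw [Baire.accepts_iff hr]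
  exact iff_of_eq (Part.mem_some_iff.1 h)

/-- The sets that have a name are exactly the open sets of the final topology. -/
theorem exists_mem_openRep_iff (δ : BaireRep X) (U : Set X) :
    (∃ p, U ∈ δ.openRep p) ↔ IsOpen[δ.finalTopology] U := by
  rw [finalTopology, isOpen_coinduced]
  constructor
  · rintro ⟨p, hp⟩
    have : δ.toPFun.asSubtype ⁻¹' U =
        (fun q : δ.toPFun.Dom => (p, (q : Baire))) ⁻¹'
          {x : Baire × Baire | Baire.Accepts x.1 x.2} := by
      ext q
      have hq : δ.toPFun.asSubtype q ∈ δ.toPFun q := ⟨q.2, rfl⟩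
      have h := mem_iff_accepts hp hq
      exact h
    rw [this]
    exact Baire.isOpen_accepts.preimage (by fun_prop)
  · intro h
    classical
    let good (w : List ℕ) : Prop := ∀ q x, x ∈ δ.toPFun q → q.Extends w → x ∈ U
    let val : List ℕ → ℕ
      | [] => 0
      | i :: w => if w.length < i then 0 else if good w then 2 else 1
    let p : Baire := fun c => ((Encodable.decode c : Option (List ℕ)).map val).getD 0
    have hp : ∀ l : List ℕ, p (Encodable.encode l) = val l := fun l => by
      simp [p]
    refine ⟨p, mem_openRep.2 fun q x hx => ?_⟩
    have hd : (Baire.app p q).Dom := by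
      intro n
      refine ⟨n, ?_⟩
      rw [hp]
      simp only [val, Baire.length_pref, lt_irrefl, if_false]
      split_ifs <;> simp
    refine ⟨_, ⟨hd, rfl⟩, ?_⟩
    rw [sierpinski, Part.mem_some_iff]
    refine propext ?_
    rw [← Baire.accepts_iff ⟨hd, rfl⟩]
    constructor
    · intro hxU
      obtain ⟨V, hV, hVU⟩ := isOpen_induced_iff.1 h
      have hqV : q ∈ V := by
        have : (⟨q, hx.1⟩ : δ.toPFun.Dom) ∈ δ.toPFun.asSubtype ⁻¹' U := by
          obtain ⟨hq, rfl⟩ := hx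
          exact hxU
        rw [← hVU] at this
        exact this
      obtain ⟨I, u, hu, hsub⟩ := isOpen_pi_iff.1 hV q hqV
      obtain ⟨n, hn⟩ : ∃ n, ∀ i ∈ I, i < n :=
        ⟨I.sup id + 1, fun i hi => Nat.lt_succ_of_le (Finset.le_sup (f := id) hi)⟩
      refine ⟨n, n, fun j hj => ?_, ?_⟩
      · rw [hp]
        simp [val, hj]
      · have hg : good (q.pref n) := by
          intro q' x' hx' he
          have he' : ∀ i < n, q i = q' i := by
            rw [Baire.Extends, Baire.length_pref] at he
            exact Baire.pref_congr.1 he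
          have hq' : q' ∈ V := hsub fun i hi => by
            rw [← he' i (hn i hi)]
            exact (hu i hi).2
          have : (⟨q', hx'.1⟩ : δ.toPFun.Dom) ∈ δ.toPFun.asSubtype ⁻¹' U := by
            rw [← hVU]
            exact hq'
          obtain ⟨_, rfl⟩ := hx'
          exact this
        rw [hp]
        simp [val, hg]
    · rintro ⟨n, m, -, h₂⟩
      rw [hp] at h₂
      have hg : good (q.pref m) := by
        by_contra hg
        simp only [val, hg, if_false] at h₂
        split_ifs at h₂ <;> omega
      exact hg q x hx (q.extends_pref m)

/-- A subset of Baire space, as a represented space: the names of `p` are just `p` itself. -/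
def ofSubset (D : Set Baire) : BaireRep D where
  toPFun p := ⟨p ∈ D, fun h => ⟨p, h⟩⟩
  surj y := ⟨y, y.2, rfl⟩

/-- A family `(B_y)` of subsets of `X`, indexed by a represented space `Y`, is a presubbase
for `X` if its transpose `X → 𝒪(Y)`, `x ↦ {y ∈ Y : x ∈ B_y}` is well-defined and injective. -/
structure IsPresubbase (δY : BaireRep Y) (B : Y → Set X) : Prop where
  isOpen : ∀ x, IsOpen[δY.finalTopology] {y | x ∈ B y}
  injective : Function.Injective fun x => {y | x ∈ B y}

/-- The presubbase representation: `δ^B(p) = x` iff `δ_{𝒪(Y)}(p) = {y ∈ Y : x ∈ B_y}`. -/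
noncomputable def presubbaseRep (δY : BaireRep Y) (B : Y → Set X)
    (hB : IsPresubbase δY B) : BaireRep X where
  toPFun p := ⟨∃ x, {y | x ∈ B y} ∈ δY.openRep p, fun h => h.choose⟩
  surj x := by
    obtain ⟨p, hp⟩ := (exists_mem_openRep_iff δY _).2 (hB.isOpen x)
    have h : ∃ x, {y | x ∈ B y} ∈ δY.openRep p := ⟨x, hp⟩
    exact ⟨p, h, hB.injective (Part.mem_unique h.choose_spec hp)⟩

theorem mem_presubbaseRep {δY : BaireRep Y} {B : Y → Set X} {hB : IsPresubbase δY B}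
    {p : Baire} {x : X} :
    x ∈ (presubbaseRep δY B hB).toPFun p ↔ {y | x ∈ B y} ∈ δY.openRep p := by
  constructor
  · rintro ⟨h, rfl⟩
    exact h.choose_spec
  · intro hp
    have h : ∃ x, {y | x ∈ B y} ∈ δY.openRep p := ⟨x, hp⟩
    exact ⟨h, hB.injective (Part.mem_unique h.choose_spec hp)⟩

/-- A topology that has all sets of a presubbase as open sets is `T₀`. -/
theorem IsPresubbase.t0Space {δY : BaireRep Y} {B : Y → Set X} (hB : IsPresubbase δY B)
    (τ : TopologicalSpace X) (h : ∀ y, IsOpen[τ] (B y)) : T0Space X := by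
  refine ⟨fun x x' hxx => hB.injective ?_⟩
  ext y
  exact hxx.mem_open_iff (h y)

theorem isOpen_presubbase {δY : BaireRep Y} {B : Y → Set X} (hB : IsPresubbase δY B)
    (y : Y) : IsOpen[(presubbaseRep δY B hB).finalTopology] (B y) := by
  rw [finalTopology, isOpen_coinduced]
  obtain ⟨s, hs⟩ := δY.surj y
  have : (presubbaseRep δY B hB).toPFun.asSubtype ⁻¹' B y =
      (fun p : (presubbaseRep δY B hB).toPFun.Dom => ((p : Baire), s)) ⁻¹'
        {x : Baire × Baire | Baire.Accepts x.1 x.2} := by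
    ext p
    have hp : (presubbaseRep δY B hB).toPFun.asSubtype p ∈ (presubbaseRep δY B hB).toPFun p :=
      ⟨p.2, rfl⟩
    have h := mem_iff_accepts (mem_presubbaseRep.1 hp) hs
    exact h
  rw [this]
  exact Baire.isOpen_accepts.preimage (by fun_prop)

end BaireRep

/-- The representations of `X` with a `T₀` final topology. -/
structure REP₀ (X : Type*) extends BaireRep X where
  t0 : @T0Space X toBaireRep.finalTopology

/-- The presubbases `B :⊆ ℕ^ℕ → 2^X` that induce a `T₀` topology on `X`: the family
`(B_y)_{y ∈ dom B}`, with the subset `dom B` of Baire space as index space, is a presubbase, and the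
topology that it generates as a subbase is `T₀`. -/
structure PRE₀ (X : Type*) where
  /-- the partial map -/
  toPFun : Baire →. Set X
  isPresubbase : BaireRep.IsPresubbase (BaireRep.ofSubset toPFun.Dom) toPFun.asSubtype
  t0 : @T0Space X (TopologicalSpace.generateFrom (Set.range toPFun.asSubtype))

/-- Computable reducibility of representations. -/
instance REP₀.instPreorder (X : Type*) : Preorder (REP₀ X) where
  le δ₁ δ₂ := ComputablyReducible δ₁.toPFun δ₂.toPFun
  le_refl _ := ComputablyReducible.refl _
  le_trans _ _ _ := ComputablyReducible.trans

/-- Computable reducibility of presubbases. -/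
instance PRE₀.instPreorder (X : Type*) : Preorder (PRE₀ X) where
  le B₁ B₂ := ComputablyReducible B₁.toPFun B₂.toPFun
  le_refl _ := ComputablyReducible.refl _
  le_trans _ _ _ := ComputablyReducible.trans

/-- The map `B ↦ δ^B`, the presubbase representation of `B`. -/
noncomputable def PRE₀.toRep {X : Type*} (B : PRE₀ X) : REP₀ X where
  toBaireRep := BaireRep.presubbaseRep _ _ B.isPresubbase
  t0 := B.isPresubbase.t0Space _ (BaireRep.isOpen_presubbase B.isPresubbase)

theorem REP₀.isPresubbase_openRep {X : Type*} (δ : REP₀ X) :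
    BaireRep.IsPresubbase (BaireRep.ofSubset δ.openRep.Dom) δ.openRep.asSubtype where
  isOpen x := by
    rw [BaireRep.finalTopology, isOpen_coinduced]
    obtain ⟨q, hq⟩ := δ.surj x
    have : (BaireRep.ofSubset δ.openRep.Dom).toPFun.asSubtype ⁻¹'
          {y | x ∈ δ.openRep.asSubtype y} =
        (fun p : (BaireRep.ofSubset δ.openRep.Dom).toPFun.Dom => ((p : Baire), q)) ⁻¹'
          {x : Baire × Baire | Baire.Accepts x.1 x.2} := by
      ext p
      have hp : δ.openRep.asSubtype p ∈ δ.openRep p := ⟨p.2, rfl⟩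
      have h := BaireRep.mem_iff_accepts hp hq
      exact h
    rw [this]
    exact Baire.isOpen_accepts.preimage (by fun_prop)
  injective x x' h := by
    let := δ.toBaireRep.finalTopology
    have := δ.t0
    refine Inseparable.eq (inseparable_iff_forall_isOpen.2 fun U hU => ?_)
    obtain ⟨p, hp, rfl⟩ := (δ.toBaireRep.exists_mem_openRep_iff U).2 hU
    exact Set.ext_iff.1 h ⟨p, hp⟩

/-- The map `δ ↦ B_δ`, the representation `δ_{𝒪(X)}` of the open sets viewed as a presubbase. -/
noncomputable def REP₀.toPre {X : Type*} (δ : REP₀ X) : PRE₀ X where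
  toPFun := δ.openRep
  isPresubbase := δ.isPresubbase_openRep
  t0 := δ.isPresubbase_openRep.t0Space _ fun y =>
    TopologicalSpace.isOpen_generateFrom_of_mem ⟨y, rfl⟩

/-! ### Exchanging the arguments of Kleene application. -/

namespace Baire

/-! Both reductions express one relation between a name `p` of `x` and an index `y` of `B`. A
reduction `F` of `δ` to `δ^B` makes `F(p) • y` a Sierpiński name of the truth value of `x ∈ B(y)`; a
reduction `F` of `B` to `B_δ` makes `F(y) • p` such a name. So it is enough to swap arguments: given
a computable `F`, find a computable `G` with `G(y) • p = F(p) • y` wherever the right side is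
defined (`IsComputable.exists_exchange`).

For this, `G(y)` at `⟨n, w⟩` treats `w` as a prefix of `p`, computes the part of `F(p)` that `w`
determines, and searches it for the first nonzero value at the positions `⟨n, y(0), …, y(j-1)⟩`,
with `j` bounded by the length of `w`. It answers `0`, "read more of `p`", until the search
succeeds. The stage of success may differ from that of `F(p) • y`, but the value found does not. -/

theorem mem_app_iff {p q r : Baire} : r ∈ app p q ↔ ∀ n, ∃ m,
    (∀ j < m, p (Encodable.encode (n :: q.pref j)) = 0) ∧
      p (Encodable.encode (n :: q.pref m)) = r n + 1 := by
  constructor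
  · rintro ⟨hd, rfl⟩ n
    refine ⟨Nat.find (hd n), fun j hj => not_not.1 (Nat.find_min (hd n) hj), ?_⟩
    have := Nat.find_spec (hd n)
    simp only [app]
    omega
  · intro h
    have hd : (app p q).Dom := fun n => by
      obtain ⟨m, -, hm⟩ := h n
      exact ⟨m, by omega⟩
    refine ⟨hd, funext fun n => ?_⟩
    obtain ⟨m, h₁, h₂⟩ := h n
    have : Nat.find (hd n) = m := by
      rw [Nat.find_eq_iff]
      exact ⟨by omega, fun j hj => not_not.2 (h₁ j hj)⟩
    simp only [app, this]
    omega

theorem Extends.getElem? {p : Baire} {u : List ℕ} (h : p.Extends u) (i : ℕ) :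
    u[i]? = if i < u.length then some (p i) else none := by
  split_ifs with hi
  · rw [h]
    simp [pref, hi]
  · simpa using hi

theorem take_pref (p : Baire) {m n : ℕ} (h : m ≤ n) : (p.pref n).take m = p.pref m := by
  have := List.prefix_iff_eq_take.1 (p.pref_prefix h)
  rw [length_pref] at this
  exact this.symm

/-- The first nonzero entry of `u` at the positions listed in `es`, and `0` if there is none or if
a position beyond the end of `u` comes first. -/
def scan (u es : List ℕ) : ℕ :=
  es.foldr (fun e a => (u[e]?.map fun k => if k = 0 then a else k).getD 0) 0

theorem scan_cons (u es : List ℕ) (e : ℕ) :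
    scan u (e :: es) = (u[e]?.map fun k => if k = 0 then scan u es else k).getD 0 := rfl

theorem primrec_scan : Primrec₂ scan := by
  unfold scan
  refine Primrec.list_foldr (h := fun (x : List ℕ × List ℕ) (y : ℕ × ℕ) => (x.1[y.1]?.map fun k =>
    if k = 0 then y.2 else k).getD 0) Primrec.snd (Primrec.const 0) ?_
  refine Primrec.option_getD.comp (Primrec.option_map ?_ ?_) (Primrec.const 0)
  · exact Primrec.list_getElem?.comp (Primrec.fst.comp Primrec.fst) (Primrec.fst.comp Primrec.snd)
  · exact Primrec.ite (Primrec.eq.comp Primrec.snd (Primrec.const 0))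
      (Primrec.snd.comp (Primrec.snd.comp Primrec.fst)) Primrec.snd

/-- Soundness of the search. Since a missing entry stops the scan instead of being skipped, all
positions before a reported value are known to hold `0`. -/
theorem exists_of_scan_ne_zero {u : List ℕ} {e : ℕ → ℕ} {m : ℕ}
    (h : scan u ((List.range m).map e) ≠ 0) :
    ∃ i < m, (∀ j < i, u[e j]? = some 0) ∧ u[e i]? = some (scan u ((List.range m).map e)) := by
  induction m generalizing e with
  | zero => simp [scan] at h
  | succ m ih =>
    rw [List.range_succ_eq_map, List.map_cons, List.map_map, scan_cons] at h ⊢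
    rcases hu : u[e 0]? with - | k
    · simp [hu] at h
    · rw [hu] at h
      by_cases hk : k = 0
      · subst hk
        simp only [Option.map_some, if_true, Option.getD_some] at h ⊢
        obtain ⟨i, him, hi, hv⟩ := ih h
        refine ⟨i + 1, by omega, fun j hj => ?_, hv⟩
        rcases j with - | j
        · exact hu
        · exact hi j (by omega)
      · exact ⟨0, by omega, by simp, by simp [hu, hk]⟩

theorem scan_eq {u : List ℕ} {e : ℕ → ℕ} {i m k : ℕ} (him : i < m)
    (h : ∀ j < i, u[e j]? = some 0) (hk : u[e i]? = some k) (hk0 : k ≠ 0) :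
    scan u ((List.range m).map e) = k := by
  induction m generalizing e i with
  | zero => omega
  | succ m ih =>
    rw [List.range_succ_eq_map, List.map_cons, List.map_map, scan_cons]
    rcases i with - | i
    · simp [hk, hk0]
    · rw [h 0 (by omega)]
      exact ih (e := e ∘ Nat.succ) (i := i) (by omega) (fun j hj => h (j + 1) (by omega)) hk

/-- The value at `c = ⟨n, w⟩` of the sequence whose application to `p` simulates the application of
`F(p)` to the sequence beginning with `v`, where `f` computes `F` on finite words. -/
def exchangeVal (f : List ℕ → List ℕ) (v : List ℕ) (c : ℕ) : ℕ :=
  scan (f (Denumerable.ofNat (List ℕ) c).tail)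
    ((List.range (Denumerable.ofNat (List ℕ) c).tail.length).map fun j =>
      Encodable.encode ((Denumerable.ofNat (List ℕ) c).headI :: v.take j))

theorem exchangeVal_encode (f : List ℕ → List ℕ) (v w : List ℕ) (n : ℕ) :
    exchangeVal f v (Encodable.encode (n :: w)) =
      scan (f w) ((List.range w.length).map fun j => Encodable.encode (n :: v.take j)) := by
  simp [exchangeVal, -Encodable.encode_list_cons]

theorem computable_exchangeVal {f : List ℕ → List ℕ} (hf : Computable f) :
    Computable₂ (exchangeVal f) := by
  have hl : Primrec fun x : List ℕ × ℕ => Denumerable.ofNat (List ℕ) x.2 :=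
    (Primrec.ofNat _).comp Primrec.snd
  have ht : Primrec fun x : List ℕ × ℕ => (Denumerable.ofNat (List ℕ) x.2).tail :=
    Primrec.list_tail.comp hl
  refine primrec_scan.to_comp.comp (hf.comp ht.to_comp) (Primrec.to_comp ?_)
  refine Primrec.list_map (Primrec.list_range.comp (Primrec.list_length.comp ht)) ?_
  exact Primrec.encode.comp (Primrec.list_cons.comp
    (Primrec.list_headI.comp (hl.comp Primrec.fst))
    (Primrec.list_take.comp Primrec.snd (Primrec.fst.comp Primrec.fst)))

/-- Entry `c` uses only the first `c` entries of the input, so a word of length `k` determines `k`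
output entries. They are appended one by one, by recursion on the length, as `g` is merely
computable. -/
theorem computable_map_range {g : List ℕ → ℕ → ℕ} (hg : Computable₂ g) :
    Computable fun v : List ℕ => (List.range v.length).map fun c => g (v.take c) c := by
  have h : Computable₂ fun (v : List ℕ) (x : ℕ × List ℕ) => x.2 ++ [g (v.take x.1) x.1] :=
    Computable.list_concat.comp (Computable.snd.comp Computable.snd)
      (hg.comp (Primrec.list_take.to_comp.comp (Computable.fst.comp Computable.snd)
        Computable.fst) (Computable.fst.comp Computable.snd))
  refine (Computable.nat_rec Computable.list_length (Computable.const []) h).of_eq fun v => ?_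
  generalize v.length = k
  induction k with
  | zero => rfl
  | succ k ih => simp [List.range_succ, ih]

theorem isComputable_of_computable₂ {g : List ℕ → ℕ → ℕ} (hg : Computable₂ g) :
    IsComputable fun y => Part.some fun c => g (y.pref c) c := by
  refine ⟨_, computable_map_range hg, fun u v huv => ?_, fun p r hr => ?_⟩
  -- Below the length of `u` the prefixes of `u` and `v` coincide, so both outputs are initial
  -- segments of one sequence.
  · have : (List.range u.length).map (fun c => g (u.take c) c) =
        (List.range u.length).map fun c => g (v.take c) c := by
      refine List.map_congr_left fun c hc => ?_
      obtain ⟨t, rfl⟩ := huv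
      rw [List.take_append_of_le_length (List.mem_range.1 hc).le]
    rw [this]
    exact pref_prefix (fun c => g (v.take c) c) huv.length_le
  · obtain rfl := Part.mem_some_iff.1 hr
    refine ⟨fun n => ?_, fun k => ⟨k, by simp⟩⟩
    simp only [Extends, List.length_map, List.length_range, length_pref]
    refine List.map_congr_left fun c hc => ?_
    rw [take_pref _ (List.mem_range.1 hc).le]

/-- The arguments `p` and `y` of `(p, y) ↦ F(p) • y` can be exchanged computably. -/
theorem IsComputable.exists_exchange {F : Baire →. Baire} (hF : IsComputable F) :
    ∃ G : Baire → Baire, IsComputable (fun y => Part.some (G y)) ∧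
      ∀ p y, ∀ q ∈ F p, ∀ r ∈ app q y, r ∈ app (G y) p := by
  obtain ⟨f, hfc, hfm, hf⟩ := hF
  refine ⟨fun y c => exchangeVal f (y.pref c) c,
    isComputable_of_computable₂ (computable_exchangeVal hfc), fun p y q hq r hr => ?_⟩
  obtain ⟨hext, hlen⟩ := hf p q hq
  -- The code of a list is at least its length, so the first `⟨n, w⟩` entries of `y` include every
  -- prefix of `y` that the search needs.
  have hval : ∀ n m, exchangeVal f (y.pref (Encodable.encode (n :: p.pref m)))
      (Encodable.encode (n :: p.pref m)) =
        scan (f (p.pref m)) ((List.range m).map fun j => Encodable.encode (n :: y.pref j)) := by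
    intro n m
    rw [exchangeVal_encode, length_pref]
    congr 1
    refine List.map_congr_left fun j hj => ?_
    have := Encodable.length_le_encode (n :: p.pref m)
    simp only [List.length_cons, length_pref] at this
    have := List.mem_range.1 hj
    rw [take_pref _ (by omega)]
  rw [mem_app_iff] at hr ⊢
  intro n
  obtain ⟨k, hk₀, hk⟩ := hr n
  -- Known entries of `f (p.pref m)` are entries of `q = F(p)`, so a successful search stops at the
  -- first nonzero query of `q • y`, which is `k`.
  have hsound : ∀ m, scan (f (p.pref m))
      ((List.range m).map fun j => Encodable.encode (n :: y.pref j)) ≠ 0 →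
      scan (f (p.pref m)) ((List.range m).map fun j => Encodable.encode (n :: y.pref j)) =
        r n + 1 := by
    intro m hm
    obtain ⟨i, -, hi₀, hi⟩ := exists_of_scan_ne_zero hm
    generalize scan (f (p.pref m)) _ = s at hm hi
    have hq : ∀ e a, (f (p.pref m))[e]? = some a → q e = a := by
      intro e a h
      rw [(hext m).getElem?] at h
      split_ifs at h
      exact Option.some.inj h
    have hi := hq _ _ hi
    have hi₀ := fun j hj => hq _ _ (hi₀ j hj)
    rcases lt_trichotomy i k with h | rfl | h
    · have := hk₀ i h
      omega
    · omega
    · have := hi₀ k h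
      omega
  -- The search succeeds once the output of `f` covers the finitely many positions queried up to `k`
  -- (all below `N`) and the search bound exceeds `k`; hence the maximum of `m` and `k + 1`.
  have hex : ∃ m, scan (f (p.pref m))
      ((List.range m).map fun j => Encodable.encode (n :: y.pref j)) ≠ 0 := by
    obtain ⟨N, hN⟩ : ∃ N, ∀ j ≤ k, Encodable.encode (n :: y.pref j) < N :=
      ⟨(Finset.range (k + 1)).sup (fun j => Encodable.encode (n :: y.pref j)) + 1, fun j hj =>
        Nat.lt_succ_of_le (Finset.le_sup (f := fun j => Encodable.encode (n :: y.pref j))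
          (Finset.mem_range.2 (Nat.lt_succ_of_le hj)))⟩
    obtain ⟨m, hm⟩ := hlen N
    have hm' : N ≤ (f (p.pref (max m (k + 1)))).length :=
      hm.trans (hfm _ _ (p.pref_prefix (le_max_left m (k + 1)))).length_le
    have hget : ∀ j ≤ k, (f (p.pref (max m (k + 1))))[Encodable.encode (n :: y.pref j)]? =
        some (q (Encodable.encode (n :: y.pref j))) := fun j hj => by
      rw [(hext _).getElem?, if_pos ((hN j hj).trans_le hm')]
    refine ⟨max m (k + 1), ?_⟩
    rw [scan_eq (i := k) (k := r n + 1) (by omega)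
      (fun j hj => by rw [hget j hj.le, hk₀ j hj]) (by rw [hget k le_rfl, hk]) (by omega)]
    omega
  classical
  -- Application reads the first nonzero answer: minimality gives the zeros before it, soundness its
  -- value.
  refine ⟨Nat.find hex, fun j hj => ?_, ?_⟩
  · refine (hval n j).trans ?_
    exact not_not.1 (Nat.find_min hex hj)
  · refine (hval n _).trans ?_
    exact hsound _ (Nat.find_spec hex)

end Baire

/-! ### The Galois connection. -/

theorem le_toRep_iff {X : Type*} (δ : REP₀ X) (B : PRE₀ X) : δ ≤ B.toRep ↔ B ≤ δ.toPre := by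
  constructor
  · rintro ⟨F, hF, h⟩
    obtain ⟨G, hG, hFG⟩ := hF.exists_exchange
    refine ⟨_, hG, fun y a ha => ⟨G y, Part.mem_some _, ?_⟩⟩
    obtain ⟨hy, rfl⟩ := ha
    refine BaireRep.mem_openRep.2 fun p x hx => ?_
    -- Here `q = F(p)` names `{y | x ∈ B y}`, and the Sierpiński name `r = q • y` is also `G y • p`.
    obtain ⟨q, hq, hxq⟩ := h p x hx
    obtain ⟨r, hr, hxr⟩ := BaireRep.mem_openRep.1
      ((BaireRep.mem_presubbaseRep (hB := B.isPresubbase)).1 hxq) y ⟨y, hy⟩ ⟨hy, rfl⟩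
    exact ⟨r, hFG p y q hq r hr, hxr⟩
  · rintro ⟨F, hF, h⟩
    obtain ⟨G, hG, hFG⟩ := hF.exists_exchange
    refine ⟨_, hG, fun p x hx => ⟨G p, Part.mem_some _, ?_⟩⟩
    refine (BaireRep.mem_presubbaseRep (hB := B.isPresubbase)).2 (BaireRep.mem_openRep.2 fun y' y hy => ?_)
    obtain ⟨hy', rfl⟩ := hy
    -- The roles are reversed: `q = F(y')` names the open set `B(y')` and is applied to the name `p`
    -- of `x`.
    obtain ⟨q, hq, hyq⟩ := h y' _ ⟨hy', rfl⟩
    obtain ⟨r, hr, hxr⟩ := BaireRep.mem_openRep.1 hyq p x hx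
    exact ⟨r, hFG y' p q hq r hr, hxr⟩

/-- Antitone Galois connection between representations and presubbases of a set `X`. -/
theorem theorem36 {X : Type*} :
    (∀ (δ : REP₀ X) (B : PRE₀ X), δ ≤ B.toRep ↔ B ≤ δ.toPre) ∧
      GaloisConnection (fun δ : REP₀ X => OrderDual.toDual δ.toPre)
        (fun B : (PRE₀ X)ᵒᵈ => (OrderDual.ofDual B).toRep) :=
  ⟨le_toRep_iff, fun δ B => (le_toRep_iff δ (OrderDual.ofDual B)).symm⟩
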